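/- Let $n\ge 1$ and let $\mathfrak S_n$ be the set of permutations of $[n]=\{1,\dots,n\}$. For $\sigma\in\mathfrak S_n$ let $\operatorname{exc}\sigma=\#\{i\in[n]:\sigma(i)>i\}$, and let $\sigma^*:[n]\to\{0,\dots,n-1\}$ be the bijection $\sigma^*(i)=\sigma(i)-1$. Put $$\operatorname{fix}^*\sigma=\#\{i\in[n-1]:\sigma^*(i)=i\},$$ $$\operatorname{cvalley}^*\sigma=\#\{i\in[n-1]:(\sigma^*)^{-1}(i)>i<\sigma^*(i)\},$$ $$\operatorname{cdd}^*\sigma=\#\{i\in[n-1]:(\sigma^*)^{-1}(i)>i>\sigma^*(i)\}.$$ The directed graph on $\{0,\dots,n\}$ with edges $i\to\sigma^*(i)$, $i\in[n]$, consists of disjoint directed cycles (loops included) and one directed path from $n$ to $0$; let $\operatorname{cyc}^*\sigma$ be the number of its cycles (the path is not counted). For $k\ge 0$ define the polynomial $$d_{n,k}(\beta)=\sum_{\substack{\sigma\in\mathfrak S_n\\ \operatorname{cvalley}^*\sigma=k,\ \operatorname{cdd}^*\sigma=0}}\beta^{\operatorname{cyc}^*\sigma-\operatorname{fix}^*\sigma}\in\mathbb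 Z[\beta].$$ Then, in $\mathbb Z[\beta][t]$, $$\sum_{\sigma\in\mathfrak S_n}\beta^{\operatorname{cyc}^*\sigma-\operatorname{fix}^*\sigma}\,t^{\operatorname{exc}\sigma}=\sum_{k=0}^{\lfloor (n-1)/2\rfloor}d_{n,k}(\beta)\,t^k(1+t)^{n-1-2k}.$$ Moreover, for every $k\ge 1$, the polynomial $d_{n,k}(\beta)$ is divisible by $\beta+1$ in $\mathbb Z[\beta]$. -/

import Mathlib

open Polynomial

/-- An index `i : Fin n` stands for the element `i + 1` of `[n] = {1, …, n}`, that is, for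
`i.succ` in `Fin (n + 1) = {0, …, n}`; so `σ : Equiv.Perm (Fin n)` is a permutation of `[n]`.
`starFun σ` is the map `σ* : [n] → {0, …, n-1}`, `σ*(i) = σ(i) - 1`: it sends the element `i.succ`
to `(σ i).succ - 1 = (σ i).castSucc`. Both its arguments and its values are compared
as elements of `Fin (n + 1)`. -/
def starFun {n : ℕ} (σ : Equiv.Perm (Fin n)) (i : Fin n) : Fin (n + 1) :=
  (σ i).castSucc

/-- The number of excedances of `σ`. -/
def excNum {n : ℕ} (σ : Equiv.Perm (Fin n)) : ℕ :=
  (Finset.univ.filter fun i : Fin n => i < σ i).card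

/-- `fix* σ`, the number of `i ∈ [n]` with `σ*(i) = i` (necessarily `i ≤ n - 1`). -/
def fixStar {n : ℕ} (σ : Equiv.Perm (Fin n)) : ℕ :=
  (Finset.univ.filter fun i : Fin n => starFun σ i = i.succ).card

/-- `cvalley* σ`, the number of `x ∈ [n-1]` with `(σ*)⁻¹(x) > x < σ*(x)`. Here `i.succ` is
`(σ*)⁻¹(x)` and `x = j.succ`; such `i` and `j` exist exactly for `x ∈ [n-1]`. -/
def cvalleyStar {n : ℕ} (σ : Equiv.Perm (Fin n)) : ℕ :=
  (Finset.univ.filter fun x : Fin (n + 1) =>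
    ∃ i j : Fin n, starFun σ i = x ∧ j.succ = x ∧ x < i.succ ∧ x < starFun σ j).card

/-- `cdd* σ`, the number of `x ∈ [n-1]` with `(σ*)⁻¹(x) > x > σ*(x)`. -/
def cddStar {n : ℕ} (σ : Equiv.Perm (Fin n)) : ℕ :=
  (Finset.univ.filter fun x : Fin (n + 1) =>
    ∃ i j : Fin n, starFun σ i = x ∧ j.succ = x ∧ x < i.succ ∧ starFun σ j < x).card

/-- The edges `x → σ*(x)`, `x ∈ [n]`, of the diagram of `σ*` on the vertices `0, …, n`. -/
def StarEdge {n : ℕ} (σ : Equiv.Perm (Fin n)) (x y : Fin (n + 1)) : Prop :=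
  ∃ i : Fin n, i.succ = x ∧ starFun σ i = y

/-- The (vertex sets of) cycles of the diagram of `σ*`: the sets of all vertices that can be reached
from some vertex `x` by at least one step, where `x` itself can be so reached. The path
`n → σ*(n) → ⋯ → 0` is not a cycle. -/
def starCycles {n : ℕ} (σ : Equiv.Perm (Fin n)) : Set (Set (Fin (n + 1))) :=
  {C | ∃ x, Relation.TransGen (StarEdge σ) x x ∧ C = {y | Relation.TransGen (StarEdge σ) x y}}

/-- `cyc* σ`, the number of cycles in the diagram of `σ*`. -/
noncomputable def cycStar {n : ℕ} (σ : Equiv.Perm (Fin n)) : ℕ :=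
  (starCycles σ).ncard

/-- A fixed point of `σ*` is a cycle, so the difference `cyc* σ - fix* σ` is never truncated. -/
theorem fixStar_le_cycStar {n : ℕ} (σ : Equiv.Perm (Fin n)) : fixStar σ ≤ cycStar σ := by
  classical
  unfold fixStar cycStar
  rw [← Set.ncard_coe_finset]
  refine Set.ncard_le_ncard_of_injOn (fun i : Fin n => ({i.succ} : Set (Fin (n + 1)))) ?_ ?_
    (Set.toFinite _)
  · intro i hi
    have hi' : starFun σ i = i.succ := by simpa using hi
    have he : StarEdge σ i.succ i.succ := ⟨i, rfl, hi'⟩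
    refine ⟨i.succ, Relation.TransGen.single he, ?_⟩
    ext y
    simp only [Set.mem_singleton_iff, Set.mem_ofPred_eq]
    constructor
    · rintro rfl
      exact Relation.TransGen.single he
    · intro h
      induction h with
      | single h =>
        obtain ⟨j, hj, hy⟩ := h
        rw [Fin.succ_inj.mp hj, hi'] at hy
        exact hy.symm
      | tail _ h ih =>
        obtain ⟨j, hj, hy⟩ := h
        rw [ih] at hj
        rw [Fin.succ_inj.mp hj, hi'] at hy
        exact hy.symm
  · intro i _ j _ h
    exact Fin.succ_inj.mp (Set.singleton_injective h)

/-- `d_{n,k}(β)`, a polynomial in `β = X` with integer coefficients: the sum of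
`β ^ (cyc* σ - fix* σ)` over the permutations of `[n]` with `cvalley* σ = k` and `cdd* σ = 0`. -/
noncomputable def dPoly (n k : ℕ) : ℤ[X] :=
  ∑ σ ∈ Finset.univ.filter (fun σ : Equiv.Perm (Fin n) => cvalleyStar σ = k ∧ cddStar σ = 0),
    X ^ (cycStar σ - fixStar σ)

/-!
Close the path from `n` to `0` by the edge `0 → n`: then `σ*` becomes a permutation `τ` of
`{0, …, n}` with `τ 0 = n`, and `cyc* σ - fix* σ` is the number of nontrivial cycles of `τ` other
than the one through `0`.

Taking `x` out of its cycle, where `x` is a double ascent, a double descent or a fixed point,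
changes neither the number of nontrivial cycles nor the shape of `τ` at any other vertex. In the
other direction, `x` becomes a double ascent or a fixed point again by being inserted into an edge
that crosses the gap above `x` upwards (being left alone takes the place of the insertion into
`0 → n`), and a double descent by being inserted into one that crosses it downwards. There are as
many edges of either kind, so only the sum of the weights of an ascent and a descent at `x` matters,
and the weights `t` and `1` may be replaced by `1 + t` and `0`.

Divisibility by `β + 1` is vanishing at `β = -1`, where the weight is the sign of `τ` up to a factor
that depends only on its fixed points. Above the greatest valley, if it is not `0`, at least two
edges cross upwards, hence at least two downwards, and exchanging the targets of two of the latter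
preserves all shapes and reverses the sign.
-/

section CyclicShape

open Equiv Equiv.Perm Finset

variable {α : Type*} [LinearOrder α]

/-- `τ` and `τ'` compare `y` in the same way with its image and with its preimage. -/
structure SameShapeAt (τ τ' : Perm α) (y : α) : Prop where
  cmp_apply : cmp y (τ y) = cmp y (τ' y)
  cmp_symm : cmp y (τ.symm y) = cmp y (τ'.symm y)

/-- The permutation obtained from `τ` by removing `x` from its cycle and making it a fixed point. -/
def isolate (τ : Perm α) (x : α) : Perm α := τ * swap (τ.symm x) x

theorem isolate_apply_self (τ : Perm α) (x : α) : isolate τ x x = x := by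
  simp [isolate]

theorem isolate_apply_symm (τ : Perm α) (x : α) : isolate τ x (τ.symm x) = τ x := by
  simp [isolate]

theorem isolate_apply_of_ne {τ : Perm α} {x y : α} (hyx : y ≠ x) (hy : y ≠ τ.symm x) :
    isolate τ x y = τ y := by
  simp [isolate, swap_apply_of_ne_of_ne hy hyx]

theorem isolate_eq_swap_mul (τ : Perm α) (x : α) : isolate τ x = swap x (τ x) * τ := by
  rw [isolate, mul_swap_eq_swap_mul, apply_symm_apply]

theorem symm_isolate (τ : Perm α) (x : α) : (isolate τ x).symm = isolate τ.symm x := by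
  rw [isolate_eq_swap_mul, ← Perm.inv_def, mul_inv_rev, swap_inv, swap_comm]
  rfl

theorem isolate_mul_swap_symm (τ : Perm α) (x : α) : isolate τ x * swap (τ.symm x) x = τ :=
  mul_swap_mul_self _ _ _

theorem symm_mul_swap_apply {ρ : Perm α} {x : α} (hx : ρ x = x) (c : α) :
    (ρ * swap c x).symm x = c := by
  simp [symm_apply_eq, hx]

theorem isolate_mul_swap {ρ : Perm α} {x : α} (hx : ρ x = x) (c : α) :
    isolate (ρ * swap c x) x = ρ := by
  rw [isolate, symm_mul_swap_apply hx, mul_swap_mul_self]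

theorem cmp_eq_cmp_of_mem_uIcc {a b x : α} (hx : x ∈ Set.uIcc a b) (ha : a ≠ x) :
    cmp a b = cmp a x := by
  rcases Set.mem_uIcc.1 hx with ⟨hax, hxb⟩ | ⟨hbx, hxa⟩
  · have hlt := hax.lt_of_ne ha
    rw [hlt.cmp_eq_lt, (hlt.trans_le hxb).cmp_eq_lt]
  · have hlt := hxa.lt_of_ne ha.symm
    rw [hlt.cmp_eq_gt, (hbx.trans_lt hlt).cmp_eq_gt]

theorem cmp_isolate_apply {τ : Perm α} {x y : α} (hx : x ∈ Set.uIcc (τ.symm x) (τ x))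
    (hyx : y ≠ x) : cmp y (isolate τ x y) = cmp y (τ y) := by
  rcases eq_or_ne y (τ.symm x) with rfl | hy
  · rw [isolate_apply_symm, apply_symm_apply, cmp_eq_cmp_of_mem_uIcc hx hyx]
  · rw [isolate_apply_of_ne hyx hy]

theorem sameShapeAt_isolate {τ : Perm α} {x y : α} (hx : x ∈ Set.uIcc (τ.symm x) (τ x))
    (hyx : y ≠ x) : SameShapeAt (isolate τ x) τ y where
  cmp_apply := cmp_isolate_apply hx hyx
  cmp_symm := by
    rw [symm_isolate]
    exact cmp_isolate_apply (by rwa [symm_symm, Set.uIcc_comm]) hyx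

theorem cmp_mul_swap_apply {τ : Perm α} {a b : α} (ha : cmp a (τ b) = cmp a (τ a))
    (hb : cmp b (τ a) = cmp b (τ b)) (y : α) : cmp y ((τ * swap a b) y) = cmp y (τ y) := by
  rw [mul_apply]
  rcases eq_or_ne y a with rfl | hya
  · rw [swap_apply_left, ha]
  rcases eq_or_ne y b with rfl | hyb
  · rw [swap_apply_right, hb]
  rw [swap_apply_of_ne_of_ne hya hyb]

variable [Fintype α]

/-- The cyclic valleys of `τ`, the elements below both their image and their preimage. The
inequality `y ≤ τ y` is then strict; it is weak so that the four possible outcomes of `y ≤ τ y` and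
`y < τ⁻¹ y` are valley, ascent, descent and peak. -/
def cycValleys (τ : Perm α) : Finset α := {y | y ≤ τ y ∧ y < τ.symm y}

/-- The cyclic double ascents of `τ` together with its fixed points. -/
def cycAscents (τ : Perm α) : Finset α := {y | y ≤ τ y ∧ τ.symm y ≤ y}

/-- The cyclic double descents of `τ`. -/
def cycDescents (τ : Perm α) : Finset α := {y | τ y < y ∧ y < τ.symm y}

theorem mem_cycValleys {τ : Perm α} {y : α} : y ∈ cycValleys τ ↔ y ≤ τ y ∧ y < τ.symm y := by
  simp [cycValleys]

theorem mem_cycValleys_iff_lt {τ : Perm α} {y : α} :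
    y ∈ cycValleys τ ↔ y < τ y ∧ y < τ.symm y := by
  rw [mem_cycValleys, and_congr_left_iff]
  exact fun hlt => ⟨fun hle => hle.lt_of_ne fun h => hlt.ne (τ.eq_symm_apply.2 h.symm), le_of_lt⟩

theorem mem_cycAscents {τ : Perm α} {y : α} : y ∈ cycAscents τ ↔ y ≤ τ y ∧ τ.symm y ≤ y := by
  simp [cycAscents]

theorem mem_cycDescents {τ : Perm α} {y : α} : y ∈ cycDescents τ ↔ τ y < y ∧ y < τ.symm y := by
  simp [cycDescents]

theorem disjoint_cycAscents_cycDescents (τ : Perm α) :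
    Disjoint (cycAscents τ) (cycDescents τ) :=
  disjoint_filter.2 fun _ _ h h' => h'.1.not_ge h.1

theorem mem_uIcc_of_mem_cycAscents {τ : Perm α} {x : α} (hx : x ∈ cycAscents τ) :
    x ∈ Set.uIcc (τ.symm x) (τ x) :=
  Set.mem_uIcc.2 (Or.inl (mem_cycAscents.1 hx).symm)

theorem mem_uIcc_of_mem_cycDescents {τ : Perm α} {x : α} (hx : x ∈ cycDescents τ) :
    x ∈ Set.uIcc (τ.symm x) (τ x) :=
  Set.mem_uIcc.2 (Or.inr ((mem_cycDescents.1 hx).imp le_of_lt le_of_lt))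

namespace SameShapeAt

variable {τ τ' : Perm α} {y : α}

theorem mem_cycValleys_iff (h : SameShapeAt τ τ' y) : y ∈ cycValleys τ ↔ y ∈ cycValleys τ' := by
  simp only [mem_cycValleys, le_iff_le_of_cmp_eq_cmp h.cmp_apply,
    lt_iff_lt_of_cmp_eq_cmp h.cmp_symm]

theorem mem_cycAscents_iff (h : SameShapeAt τ τ' y) : y ∈ cycAscents τ ↔ y ∈ cycAscents τ' := by
  simp only [mem_cycAscents, le_iff_le_of_cmp_eq_cmp h.cmp_apply, ← not_lt,
    lt_iff_lt_of_cmp_eq_cmp h.cmp_symm]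

theorem mem_cycDescents_iff (h : SameShapeAt τ τ' y) :
    y ∈ cycDescents τ ↔ y ∈ cycDescents τ' := by
  rw [mem_cycDescents, mem_cycDescents, ← not_le, le_iff_le_of_cmp_eq_cmp h.cmp_apply, not_le,
    lt_iff_lt_of_cmp_eq_cmp h.cmp_symm]

end SameShapeAt

theorem cycValleys_isolate {τ : Perm α} {x : α} (hx : x ∈ Set.uIcc (τ.symm x) (τ x)) :
    cycValleys (isolate τ x) = cycValleys τ := by
  ext y
  rcases eq_or_ne y x with rfl | hyx
  · have hisolate : y ∉ cycValleys (isolate τ y) := by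
      simp [mem_cycValleys_iff_lt, isolate_apply_self]
    have hτ : y ∉ cycValleys τ := by
      rw [mem_cycValleys_iff_lt, ← lt_inf_iff, inf_comm]
      exact hx.1.not_gt
    exact iff_of_false hisolate hτ
  · exact (sameShapeAt_isolate hx hyx).mem_cycValleys_iff

theorem card_cycAscents_add_card_cycValleys (τ : Perm α) :
    #(cycAscents τ) + #(cycValleys τ) = #{y | y ≤ τ y} := by
  rw [← card_filter_add_card_filter_not (s := {y | y ≤ τ y}) (fun y => τ.symm y ≤ y),
    filter_filter, filter_filter]
  simp only [cycAscents, cycValleys, not_le]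

theorem card_cycDescents_add_card_cycValleys (τ : Perm α) :
    #(cycDescents τ) + #(cycValleys τ) = #{y | τ y < y} := by
  have hsymm : #{y | τ y < y} = #{y | y < τ.symm y} :=
    card_bij' (fun y _ => τ y) (fun y _ => τ.symm y) (by simp) (by simp) (by simp) (by simp)
  rw [hsymm, ← card_filter_add_card_filter_not (s := {y | y < τ.symm y}) (fun y => τ y < y),
    filter_filter, filter_filter]
  simp only [cycDescents, cycValleys, not_lt, and_comm]

theorem card_cycAscents_add_card_cycDescents_add (τ : Perm α) :
    #(cycAscents τ) + #(cycDescents τ) + 2 * #(cycValleys τ) = Fintype.card α := by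
  have hcard := card_filter_add_card_filter_not (s := (univ : Finset α)) (fun y => y ≤ τ y)
  simp only [not_le, ← card_cycAscents_add_card_cycValleys,
    ← card_cycDescents_add_card_cycValleys, card_univ] at hcard
  omega

/-- The sources of the edges of the diagram of `τ` that cross the gap above `v` downwards. -/
def downCrossings (τ : Perm α) (v : α) : Finset α := {c | v < c ∧ τ c ≤ v}

theorem mem_downCrossings {τ : Perm α} {v c : α} :
    c ∈ downCrossings τ v ↔ v < c ∧ τ c ≤ v := by
  simp [downCrossings]

theorem card_up_crossings_eq_card_downCrossings (τ : Perm α) (v : α) :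
    #{c | c ≤ v ∧ v < τ c} = #(downCrossings τ v) := by
  have hsource := card_filter_add_card_filter_not (s := {c | c ≤ v}) (fun c => τ c ≤ v)
  have htarget := card_filter_add_card_filter_not (s := {c | τ c ≤ v}) (fun c => c ≤ v)
  have himage : #{c | τ c ≤ v} = #{c | c ≤ v} :=
    card_bij' (fun c _ => τ c) (fun c _ => τ.symm c) (by simp) (by simp) (by simp) (by simp)
  simp only [filter_filter, not_le] at hsource htarget
  simp only [and_comm (a := τ _ ≤ v)] at htarget
  rw [downCrossings]
  omega

end CyclicShape

section Balance

open Equiv Equiv.Perm Finset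

variable {α : Type*} [LinearOrder α] [BoundedOrder α] [Nontrivial α] {τ : Perm α} {x : α}

theorem ne_bot_of_mem_uIcc (hτ : τ ⊥ = ⊤) (hx : x ∈ Set.uIcc (τ.symm x) (τ x)) : x ≠ ⊥ := by
  rintro rfl
  rcases Set.mem_uIcc.1 hx with ⟨h, -⟩ | ⟨h, -⟩
  · rw [le_bot_iff, symm_apply_eq, hτ] at h
    exact bot_ne_top h
  · rw [hτ, le_bot_iff] at h
    exact top_ne_bot h

theorem ne_top_of_mem_uIcc (hτ : τ ⊥ = ⊤) (hx : x ∈ Set.uIcc (τ.symm x) (τ x)) : x ≠ ⊤ := by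
  rintro rfl
  rw [← hτ, symm_apply_apply, hτ] at hx
  rcases Set.mem_uIcc.1 hx with ⟨-, h⟩ | ⟨-, h⟩
  · exact top_ne_bot (τ.injective ((top_le_iff.1 h).trans hτ.symm))
  · exact bot_ne_top (top_le_iff.1 h)

theorem isolate_bot (hτ : τ ⊥ = ⊤) (hx : x ∈ Set.uIcc (τ.symm x) (τ x)) :
    isolate τ x ⊥ = ⊤ := by
  rw [isolate_apply_of_ne (ne_bot_of_mem_uIcc hτ hx).symm, hτ]
  rw [ne_eq, eq_symm_apply, hτ]
  exact (ne_top_of_mem_uIcc hτ hx).symm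

variable [Fintype α] {ρ : Perm α}

theorem bot_mem_cycValleys (hτ : τ ⊥ = ⊤) : ⊥ ∈ cycValleys τ := by
  rw [mem_cycValleys, bot_lt_iff_ne_bot, ne_eq, symm_apply_eq, hτ]
  exact ⟨bot_le, bot_ne_top⟩

theorem card_isolate_fiber (hρ : ρ ⊥ = ⊤) (hx : ρ x = x) (p : Perm α → Prop)
    [DecidablePred p] :
    #{τ | (τ ⊥ = ⊤ ∧ p τ) ∧ isolate τ x = ρ} = #{c | c ≠ ⊥ ∧ p (ρ * swap c x)} := by
  have hx_bot : x ≠ ⊥ := by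
    rintro rfl
    exact bot_ne_top (hx.symm.trans hρ)
  have hx_top : x ≠ ⊤ := by
    rintro rfl
    exact top_ne_bot (ρ.injective (hx.trans hρ.symm))
  refine card_bij' (fun τ _ => τ.symm x) (fun c _ => ρ * swap c x) ?_ ?_ ?_ ?_
  · intro τ hτ
    obtain ⟨⟨hτ_bot, hp⟩, rfl⟩ := (mem_filter_univ τ).1 hτ
    rw [mem_filter_univ, isolate_mul_swap_symm, ne_eq, symm_apply_eq, hτ_bot]
    exact ⟨hx_top, hp⟩
  · intro c hc
    obtain ⟨hc, hp⟩ := (mem_filter_univ c).1 hc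
    rw [mem_filter_univ, mul_apply, swap_apply_of_ne_of_ne hc.symm hx_bot.symm]
    exact ⟨⟨hρ, hp⟩, isolate_mul_swap hx c⟩
  · intro τ hτ
    obtain ⟨-, rfl⟩ := (mem_filter_univ τ).1 hτ
    exact isolate_mul_swap_symm τ x
  · exact fun c _ => symm_mul_swap_apply hx c

theorem card_isolate_fiber_cycDescents (hρ : ρ ⊥ = ⊤) (hx : ρ x = x) :
    #{τ | (τ ⊥ = ⊤ ∧ x ∈ cycDescents τ) ∧ isolate τ x = ρ} = #(downCrossings ρ x) := by
  rw [card_isolate_fiber hρ hx]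
  congr 1
  ext c
  rw [mem_filter_univ, mem_cycDescents, mem_downCrossings, symm_mul_swap_apply hx, mul_apply,
    swap_apply_right]
  constructor
  · exact fun ⟨_, hρc, hxc⟩ => ⟨hxc, hρc.le⟩
  · rintro ⟨hxc, hρc⟩
    refine ⟨hxc.ne_bot, hρc.lt_of_ne fun h => hxc.ne' ?_, hxc⟩
    exact ρ.injective (h.trans hx.symm)

theorem card_isolate_fiber_cycAscents (hρ : ρ ⊥ = ⊤) (hx : ρ x = x) :
    #{τ | (τ ⊥ = ⊤ ∧ x ∈ cycAscents τ) ∧ isolate τ x = ρ} = #{c | c ≤ x ∧ x < ρ c} := by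
  -- The insertion at `x` itself, a fixed point, plays the role of an insertion into `⊥ → ⊤`.
  have herase_bot : ({c | c ≠ ⊥ ∧ x ∈ cycAscents (ρ * swap c x)} : Finset α) =
      ({c | c ≤ x ∧ x ≤ ρ c} : Finset α).erase ⊥ := by
    ext c
    simp [mem_cycAscents, symm_mul_swap_apply hx, and_comm (a := x ≤ _)]
  have herase_self : ({c | c ≤ x ∧ x < ρ c} : Finset α) =
      ({c | c ≤ x ∧ x ≤ ρ c} : Finset α).erase x := by
    ext c
    have hne : x ≠ ρ c ↔ c ≠ x := by
      rw [← ρ.injective.ne_iff (x := c), hx, ne_comm]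
    simp only [mem_filter_univ, mem_erase, lt_iff_le_and_ne, hne]
    tauto
  rw [card_isolate_fiber hρ hx, herase_bot, herase_self, card_erase_of_mem, card_erase_of_mem] <;>
    simp [hρ, hx]

theorem sum_filter_eq_sum_card_isolate_fiber {M : Type*} [AddCommMonoid M] {Φ : Perm α → M}
    (p : Perm α → Prop) [DecidablePred p] (hp : ∀ τ, p τ → x ∈ Set.uIcc (τ.symm x) (τ x))
    (hΦ : ∀ τ : Perm α, x ∈ Set.uIcc (τ.symm x) (τ x) → Φ (isolate τ x) = Φ τ) :
    ∑ τ with τ ⊥ = ⊤ ∧ p τ, Φ τ =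
      ∑ ρ with ρ ⊥ = ⊤ ∧ ρ x = x, #{τ | (τ ⊥ = ⊤ ∧ p τ) ∧ isolate τ x = ρ} • Φ ρ := by
  have hmaps : ∀ τ ∈ ({τ | τ ⊥ = ⊤ ∧ p τ} : Finset (Perm α)),
      isolate τ x ∈ ({ρ | ρ ⊥ = ⊤ ∧ ρ x = x} : Finset (Perm α)) := by
    intro τ hτ
    obtain ⟨hτ, hpτ⟩ := (mem_filter_univ τ).1 hτ
    exact (mem_filter_univ _).2 ⟨isolate_bot hτ (hp τ hpτ), isolate_apply_self τ x⟩
  rw [← sum_fiberwise_of_maps_to hmaps]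
  refine sum_congr rfl fun ρ _ => ?_
  rw [filter_filter]
  refine sum_eq_card_nsmul fun τ hτ => ?_
  obtain ⟨⟨-, hpτ⟩, rfl⟩ := (mem_filter_univ τ).1 hτ
  exact (hΦ τ (hp τ hpτ)).symm

theorem sum_cycAscents_eq_sum_cycDescents {M : Type*} [AddCommMonoid M] {Φ : Perm α → M}
    (hΦ : ∀ τ : Perm α, x ∈ Set.uIcc (τ.symm x) (τ x) → Φ (isolate τ x) = Φ τ) :
    ∑ τ with τ ⊥ = ⊤ ∧ x ∈ cycAscents τ, Φ τ = ∑ τ with τ ⊥ = ⊤ ∧ x ∈ cycDescents τ, Φ τ := by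
  rw [sum_filter_eq_sum_card_isolate_fiber _ (fun _ => mem_uIcc_of_mem_cycAscents) hΦ,
    sum_filter_eq_sum_card_isolate_fiber _ (fun _ => mem_uIcc_of_mem_cycDescents) hΦ]
  refine sum_congr rfl fun ρ hρ => ?_
  obtain ⟨hρ, hx⟩ := (mem_filter_univ ρ).1 hρ
  rw [card_isolate_fiber_cycAscents hρ hx, card_isolate_fiber_cycDescents hρ hx,
    card_up_crossings_eq_card_downCrossings]

end Balance

section ShapeWeight

open Equiv Equiv.Perm Finset

theorem prod_eq_ite_mul_prod_update_one {α R : Type*} [DecidableEq α] [CommMonoid R]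
    (s : Finset α) (f : α → R) (x : α) :
    ∏ y ∈ s, f y = (if x ∈ s then f x else 1) * ∏ y ∈ s, Function.update f x 1 y := by
  split_ifs with hx
  · rw [prod_update_of_mem hx, one_mul, sdiff_singleton_eq_erase, mul_prod_erase _ _ hx]
  · rw [prod_update_of_notMem hx, one_mul]

variable {α : Type*} [LinearOrder α] [Fintype α] {R : Type*} [CommSemiring R]

/-- The multiplicative weight of `τ` in which each ascent or fixed point `y` counts `a y` and each
descent `y` counts `d y`. -/
def shapeWeight (a d : α → R) (τ : Perm α) : R :=
  (∏ y ∈ cycAscents τ, a y) * ∏ y ∈ cycDescents τ, d y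

theorem shapeWeight_const (a d : R) (τ : Perm α) :
    shapeWeight (fun _ => a) (fun _ => d) τ = a ^ #(cycAscents τ) * d ^ #(cycDescents τ) := by
  simp [shapeWeight]

theorem shapeWeight_isolate {a d : α → R} {τ : Perm α} {x : α}
    (hx : x ∈ Set.uIcc (τ.symm x) (τ x)) (ha : a x = 1) (hd : d x = 1) :
    shapeWeight a d (isolate τ x) = shapeWeight a d τ := by
  have hasc : (cycAscents (isolate τ x)).erase x = (cycAscents τ).erase x := by
    ext y
    simp only [mem_erase]
    exact and_congr_right fun hyx => (sameShapeAt_isolate hx hyx).mem_cycAscents_iff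
  have hdesc : (cycDescents (isolate τ x)).erase x = (cycDescents τ).erase x := by
    ext y
    simp only [mem_erase]
    exact and_congr_right fun hyx => (sameShapeAt_isolate hx hyx).mem_cycDescents_iff
  rw [shapeWeight, shapeWeight, ← prod_erase _ ha, ← prod_erase _ hd, hasc, hdesc,
    prod_erase _ ha, prod_erase _ hd]

variable [BoundedOrder α] [Nontrivial α]

theorem sum_mul_shapeWeight_eq {Φ : Perm α → R} {x : α}
    (hΦ : ∀ τ : Perm α, x ∈ Set.uIcc (τ.symm x) (τ x) → Φ (isolate τ x) = Φ τ)
    (a d : α → R) {Q : Perm α → R}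
    (hQ : ∀ τ, Q τ = Φ τ * shapeWeight (Function.update a x 1) (Function.update d x 1) τ) :
    ∑ τ with τ ⊥ = ⊤, Φ τ * shapeWeight a d τ =
      (a x + d x) * ∑ τ with τ ⊥ = ⊤ ∧ x ∈ cycDescents τ, Q τ +
        ∑ τ with τ ⊥ = ⊤ ∧ x ∉ cycAscents τ ∧ x ∉ cycDescents τ, Q τ := by
  have hsplit : ∀ τ, Φ τ * shapeWeight a d τ =
      (if x ∈ cycAscents τ then a x * Q τ else 0) + (if x ∈ cycDescents τ then d x * Q τ else 0) +
        if x ∉ cycAscents τ ∧ x ∉ cycDescents τ then Q τ else 0 := by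
    intro τ
    have hdisj : x ∈ cycAscents τ → x ∉ cycDescents τ :=
      fun h => Finset.disjoint_left.1 (disjoint_cycAscents_cycDescents τ) h
    rw [hQ, shapeWeight, prod_eq_ite_mul_prod_update_one _ a x,
      prod_eq_ite_mul_prod_update_one _ d x, shapeWeight]
    by_cases hasc : x ∈ cycAscents τ
    · simp only [hasc, hdisj hasc, if_true, if_false, not_true_eq_false, false_and, add_zero]
      ring
    · by_cases hdesc : x ∈ cycDescents τ
      · simp only [hasc, hdesc, if_true, if_false, not_true_eq_false, and_false, add_zero, zero_add]
        ring
      · simp only [hasc, hdesc, if_false, not_false_eq_true, and_self, if_true, one_mul, zero_add]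
  have hQ_isolate : ∀ τ : Perm α, x ∈ Set.uIcc (τ.symm x) (τ x) → Q (isolate τ x) = Q τ := by
    intro τ hx
    rw [hQ, hQ, hΦ τ hx, shapeWeight_isolate hx (Function.update_self ..)
      (Function.update_self ..)]
  simp only [hsplit, sum_add_distrib, ← sum_filter, filter_filter, ← mul_sum]
  rw [sum_cycAscents_eq_sum_cycDescents hQ_isolate, add_mul]

variable {Φ : Perm α → R}
  (hΦ : ∀ (τ : Perm α) (x : α), x ∈ Set.uIcc (τ.symm x) (τ x) → Φ (isolate τ x) = Φ τ)

include hΦ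

theorem sum_mul_shapeWeight_update (a d : α → R) {x : α} {u v : R} (huv : a x + d x = u + v) :
    ∑ τ with τ ⊥ = ⊤, Φ τ * shapeWeight a d τ =
      ∑ τ with τ ⊥ = ⊤,
        Φ τ * shapeWeight (Function.update a x u) (Function.update d x v) τ := by
  rw [sum_mul_shapeWeight_eq (fun τ => hΦ τ x) a d fun _ => rfl,
    sum_mul_shapeWeight_eq (fun τ => hΦ τ x) (Function.update a x u) (Function.update d x v)
      fun _ => rfl]
  simp only [Function.update_self, Function.update_idem, huv]

theorem sum_mul_shapeWeight_congr {a d a' d' : α → R} (h : ∀ y, a y + d y = a' y + d' y) :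
    ∑ τ with τ ⊥ = ⊤, Φ τ * shapeWeight a d τ =
      ∑ τ with τ ⊥ = ⊤, Φ τ * shapeWeight a' d' τ := by
  suffices hpiecewise : ∀ S : Finset α, ∑ τ with τ ⊥ = ⊤, Φ τ * shapeWeight a d τ =
      ∑ τ with τ ⊥ = ⊤, Φ τ * shapeWeight (S.piecewise a' a) (S.piecewise d' d) τ by
    simpa using hpiecewise univ
  intro S
  induction S using Finset.induction_on with
  | empty => simp
  | insert x S hx ih =>
    rw [ih, piecewise_insert, piecewise_insert]
    refine sum_mul_shapeWeight_update hΦ _ _ ?_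
    rw [piecewise_eq_of_notMem _ _ _ hx, piecewise_eq_of_notMem _ _ _ hx, h]

theorem sum_mul_pow_card_cycAscents_mul_pow_card_cycDescents (a d : R) :
    ∑ τ with τ ⊥ = ⊤, Φ τ * (a ^ #(cycAscents τ) * d ^ #(cycDescents τ)) =
      ∑ τ with τ ⊥ = ⊤ ∧ cycDescents τ = ∅, Φ τ * (a + d) ^ #(cycAscents τ) := by
  have h := sum_mul_shapeWeight_congr hΦ (a := fun _ => a) (d := fun _ => d)
    (a' := fun _ => a + d) (d' := fun _ => 0) fun _ => (add_zero _).symm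
  simp only [shapeWeight_const, zero_pow_eq, card_eq_zero, mul_ite, mul_one, mul_zero] at h
  rw [h, ← sum_filter, filter_filter]

end ShapeWeight

section CycleType

open Equiv Equiv.Perm Finset

variable {α : Type*}

theorem card_cycleType_swap_mul [DecidableEq α] [Fintype α] {τ : Perm α} {x : α}
    (hx : τ x ≠ x) (hτx : τ (τ x) ≠ x) :
    (swap x (τ x) * τ).cycleType.card = τ.cycleType.card := by
  set f := τ.cycleOf x
  have hfx : f x = τ x := cycleOf_apply_self τ x
  have hffx : f (f x) = τ (τ x) := by
    rw [hfx]
    exact (SameCycle.refl τ x).apply_right.cycleOf_apply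
  have hf_cycle : f.IsCycle := isCycle_cycleOf τ hx
  have hf_cycle' : (swap x (f x) * f).IsCycle :=
    hf_cycle.swap_mul (by rwa [hfx]) (by rwa [hffx])
  have hdisj : Disjoint f (τ * f⁻¹) :=
    (disjoint_mul_inv_of_mem_cycleFactorsFinset
      (cycleOf_mem_cycleFactorsFinset_iff.2 (mem_support.2 hx))).symm
  have hdisj' : Disjoint (swap x (f x) * f) (τ * f⁻¹) :=
    disjoint_iff_disjoint_support.2 ((disjoint_iff_disjoint_support.1 hdisj).mono_left
      fun y hy => (mem_support_swap_mul_imp_mem_support_ne hy).1)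
  have hτ : f * (τ * f⁻¹) = τ := by
    rw [hdisj.commute.eq, inv_mul_cancel_right]
  calc (swap x (τ x) * τ).cycleType.card
    _ = (swap x (f x) * f * (τ * f⁻¹)).cycleType.card := by rw [mul_assoc, hτ, hfx]
    _ = (f * (τ * f⁻¹)).cycleType.card := by
      rw [hdisj'.cycleType_mul, hdisj.cycleType_mul, Multiset.card_add, Multiset.card_add,
        card_cycleType_eq_one.2 hf_cycle', card_cycleType_eq_one.2 hf_cycle]
    _ = τ.cycleType.card := by rw [hτ]

theorem card_cycleType_isolate [LinearOrder α] [Fintype α] {τ : Perm α} {x : α}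
    (hx : x ∈ Set.uIcc (τ.symm x) (τ x)) :
    (isolate τ x).cycleType.card = τ.cycleType.card := by
  rw [isolate_eq_swap_mul]
  rcases eq_or_ne (τ x) x with hfix | hmove
  · rw [hfix, swap_self, ← Perm.one_def, one_mul]
  · refine card_cycleType_swap_mul hmove fun h => hmove ?_
    rw [(symm_apply_eq τ).2 h.symm, Set.uIcc_self] at hx
    exact (Set.mem_singleton_iff.1 hx).symm

end CycleType

section SignReversing

open Equiv Equiv.Perm Finset

variable {α : Type*} [LinearOrder α] [Fintype α] {τ : Perm α} {v a b : α}

theorem sameShapeAt_mul_swap (ha : a ∈ downCrossings τ v) (hb : b ∈ downCrossings τ v) (y : α) :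
    SameShapeAt (τ * swap a b) τ y := by
  obtain ⟨hva, hav⟩ := mem_downCrossings.1 ha
  obtain ⟨hvb, hbv⟩ := mem_downCrossings.1 hb
  have hsymm : (τ * swap a b).symm = τ.symm * swap (τ a) (τ b) := by
    rw [mul_swap_eq_swap_mul, ← Perm.inv_def, mul_inv_rev, swap_inv, Perm.inv_def]
  refine ⟨cmp_mul_swap_apply ?_ ?_ y, hsymm ▸ cmp_mul_swap_apply ?_ ?_ y⟩
  · rw [(hbv.trans_lt hva).cmp_eq_gt, (hav.trans_lt hva).cmp_eq_gt]
  · rw [(hav.trans_lt hvb).cmp_eq_gt, (hbv.trans_lt hvb).cmp_eq_gt]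
  · rw [symm_apply_apply, symm_apply_apply, (hav.trans_lt hvb).cmp_eq_lt,
      (hav.trans_lt hva).cmp_eq_lt]
  · rw [symm_apply_apply, symm_apply_apply, (hbv.trans_lt hva).cmp_eq_lt,
      (hbv.trans_lt hvb).cmp_eq_lt]

theorem downCrossings_mul_swap (ha : a ∈ downCrossings τ v) (hb : b ∈ downCrossings τ v) :
    downCrossings (τ * swap a b) v = downCrossings τ v := by
  obtain ⟨-, hav⟩ := mem_downCrossings.1 ha
  obtain ⟨-, hbv⟩ := mem_downCrossings.1 hb
  ext y
  rw [mem_downCrossings, mem_downCrossings, mul_apply]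
  rcases eq_or_ne y a with rfl | hya
  · simp only [swap_apply_left, hav, hbv]
  rcases eq_or_ne y b with rfl | hyb
  · simp only [swap_apply_right, hav, hbv]
  rw [swap_apply_of_ne_of_ne hya hyb]

theorem neg_one_pow_card_cycleType_of_support_eq {τ τ' : Perm α} (hsupp : τ'.support = τ.support)
    (hsign : sign τ' = -sign τ) :
    (-1 : ℤ) ^ τ.cycleType.card + (-1) ^ τ'.cycleType.card = 0 := by
  rw [sign_of_cycleType, sign_of_cycleType, sum_cycleType, sum_cycleType, hsupp, pow_add, pow_add,
    ← mul_neg, mul_right_inj] at hsign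
  have hint := congrArg (fun u : ℤˣ => (u : ℤ)) hsign
  push_cast at hint
  rw [hint, add_neg_cancel]

theorem neg_one_pow_card_cycleType_mul_swap (hab : a ≠ b) (ha : a ∈ downCrossings τ v)
    (hb : b ∈ downCrossings τ v) :
    (-1 : ℤ) ^ τ.cycleType.card + (-1) ^ (τ * swap a b).cycleType.card = 0 := by
  refine neg_one_pow_card_cycleType_of_support_eq ?_ ?_
  · ext y
    rw [mem_support, mem_support, ne_comm, ne_comm (a := τ y)]
    exact (eq_iff_eq_of_cmp_eq_cmp (sameShapeAt_mul_swap ha hb y).cmp_apply).not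
  · rw [Perm.sign_mul, sign_swap hab, mul_neg_one]

variable [BoundedOrder α]

theorem one_lt_card_downCrossings (hτ : τ ⊥ = ⊤) (hv : v ≠ ⊥) (hval : v ∈ cycValleys τ) :
    1 < #(downCrossings τ v) := by
  have hlt : v < τ v := (mem_cycValleys_iff_lt.1 hval).1
  rw [← card_up_crossings_eq_card_downCrossings, one_lt_card]
  refine ⟨v, (mem_filter_univ v).2 ⟨le_rfl, hlt⟩, ⊥, (mem_filter_univ ⊥).2 ⟨bot_le, ?_⟩, hv⟩
  exact hτ ▸ hlt.trans_le le_top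

/-- The greatest cyclic valley of `τ`. -/
def lastValley (τ : Perm α) : α := (cycValleys τ).sup id

/-- The permutation obtained from `τ` by exchanging the targets of two edges of its diagram that
cross the gap above the last valley downwards, the ones with the least and the greatest source. -/
def exchange (τ : Perm α) : Perm α :=
  τ * swap ((downCrossings τ (lastValley τ)).inf id) ((downCrossings τ (lastValley τ)).sup id)

theorem one_lt_card_downCrossings_lastValley (hτ : τ ⊥ = ⊤) (hval : 1 < #(cycValleys τ)) :
    1 < #(downCrossings τ (lastValley τ)) := by
  obtain ⟨v, hv, hv_bot⟩ := exists_mem_ne hval ⊥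
  refine one_lt_card_downCrossings hτ (fun hbot => ?_) ?_
  · exact hv_bot (le_bot_iff.1 (hbot ▸ le_sup (f := id) hv))
  · simpa [lastValley] using sup_mem_of_nonempty (f := id) ⟨v, hv⟩

theorem exists_exchange_eq_mul_swap (hτ : τ ⊥ = ⊤) (hval : 1 < #(cycValleys τ)) :
    ∃ a ∈ downCrossings τ (lastValley τ), ∃ b ∈ downCrossings τ (lastValley τ),
      a ≠ b ∧ exchange τ = τ * swap a b := by
  obtain ⟨c, hc, c', hc', hcc'⟩ := one_lt_card.1 (one_lt_card_downCrossings_lastValley hτ hval)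
  refine ⟨_, by simpa using inf_mem_of_nonempty (f := id) ⟨c, hc⟩, _,
    by simpa using sup_mem_of_nonempty (f := id) ⟨c, hc⟩, fun heq => hcc' ?_, rfl⟩
  exact le_antisymm ((le_sup (f := id) hc).trans (heq ▸ inf_le (f := id) hc'))
    ((le_sup (f := id) hc').trans (heq ▸ inf_le (f := id) hc))

theorem sameShapeAt_exchange (hτ : τ ⊥ = ⊤) (hval : 1 < #(cycValleys τ)) (y : α) :
    SameShapeAt (exchange τ) τ y := by
  obtain ⟨a, ha, b, hb, -, h⟩ := exists_exchange_eq_mul_swap hτ hval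
  exact h ▸ sameShapeAt_mul_swap ha hb y

theorem exchange_bot (hτ : τ ⊥ = ⊤) (hval : 1 < #(cycValleys τ)) : exchange τ ⊥ = ⊤ := by
  obtain ⟨a, ha, b, hb, -, h⟩ := exists_exchange_eq_mul_swap hτ hval
  rw [h, mul_apply, swap_apply_of_ne_of_ne, hτ]
  · exact (mem_downCrossings.1 ha).1.ne_bot.symm
  · exact (mem_downCrossings.1 hb).1.ne_bot.symm

theorem cycValleys_exchange (hτ : τ ⊥ = ⊤) (hval : 1 < #(cycValleys τ)) :
    cycValleys (exchange τ) = cycValleys τ :=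
  ext fun y => (sameShapeAt_exchange hτ hval y).mem_cycValleys_iff

theorem cycDescents_exchange (hτ : τ ⊥ = ⊤) (hval : 1 < #(cycValleys τ)) :
    cycDescents (exchange τ) = cycDescents τ :=
  ext fun y => (sameShapeAt_exchange hτ hval y).mem_cycDescents_iff

theorem exchange_exchange (hτ : τ ⊥ = ⊤) (hval : 1 < #(cycValleys τ)) :
    exchange (exchange τ) = τ := by
  have hlast : lastValley (exchange τ) = lastValley τ := by
    rw [lastValley, cycValleys_exchange hτ hval, lastValley]
  have hdown : downCrossings (exchange τ) (lastValley τ) = downCrossings τ (lastValley τ) := by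
    obtain ⟨a, ha, b, hb, -, h⟩ := exists_exchange_eq_mul_swap hτ hval
    rw [h, downCrossings_mul_swap ha hb]
  rw [exchange, hlast, hdown, exchange, mul_swap_mul_self]

theorem neg_one_pow_card_cycleType_exchange (hτ : τ ⊥ = ⊤) (hval : 1 < #(cycValleys τ)) :
    (-1 : ℤ) ^ τ.cycleType.card + (-1) ^ (exchange τ).cycleType.card = 0 := by
  obtain ⟨a, ha, b, hb, hab, h⟩ := exists_exchange_eq_mul_swap hτ hval
  exact h ▸ neg_one_pow_card_cycleType_mul_swap hab ha hb

theorem sum_neg_one_pow_card_cycleType_eq_zero {k : ℕ} (hk : 1 < k) :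
    ∑ τ : Perm α with τ ⊥ = ⊤ ∧ #(cycValleys τ) = k ∧ cycDescents τ = ∅,
      (-1 : ℤ) ^ τ.cycleType.card = 0 := by
  have hval : ∀ τ ∈ ({τ | τ ⊥ = ⊤ ∧ #(cycValleys τ) = k ∧ cycDescents τ = ∅} : Finset (Perm α)),
      τ ⊥ = ⊤ ∧ 1 < #(cycValleys τ) := by
    intro τ hτ
    obtain ⟨hτ_bot, hcard, -⟩ := (mem_filter_univ τ).1 hτ
    exact ⟨hτ_bot, hcard ▸ hk⟩
  have hcancel τ hτ := neg_one_pow_card_cycleType_exchange (hval τ hτ).1 (hval τ hτ).2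
  refine sum_involution (fun τ _ => exchange τ) hcancel (fun τ hτ hne heq => ?_)
    (fun τ hτ => ?_) fun τ hτ => exchange_exchange (hval τ hτ).1 (hval τ hτ).2
  · have h := hcancel τ hτ
    rw [heq, add_self_eq_zero] at h
    exact hne h
  · obtain ⟨hτ_bot, hcard⟩ := hval τ hτ
    rw [mem_filter_univ] at hτ ⊢
    rw [cycValleys_exchange hτ_bot hcard, cycDescents_exchange hτ_bot hcard]
    exact ⟨exchange_bot hτ_bot hcard, hτ.2⟩

end SignReversing

section Orbits

open Equiv Equiv.Perm Finset

variable {α : Type*} {τ : Perm α}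

theorem setOf_sameCycle_eq_singleton {x : α} (hx : τ x = x) : {y | τ.SameCycle y x} = {x} := by
  ext y
  exact ⟨fun h => h.eq_of_right hx, fun h => h ▸ SameCycle.refl _ _⟩

variable [DecidableEq α] [Fintype α]

theorem coe_support_eq_setOf_sameCycle {c : Perm α} (hc : c ∈ τ.cycleFactorsFinset) {x : α}
    (hx : x ∈ c.support) : (c.support : Set α) = {y | τ.SameCycle y x} := by
  have hmove : τ x ≠ x := mem_support.1 (mem_cycleFactorsFinset_support_le hc hx)
  ext y
  rw [mem_coe, cycle_is_cycleOf hx hc, mem_support_cycleOf_iff' hmove, sameCycle_comm,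
    Set.mem_ofPred_eq]

theorem classes_sameCycle_eq_union (τ : Perm α) :
    (SameCycle.setoid τ).classes =
      (fun c : Perm α => (c.support : Set α)) '' τ.cycleFactorsFinset ∪
        singleton '' ({x | τ x = x} : Finset α) := by
  ext C
  constructor
  · rintro ⟨x, rfl⟩
    rcases eq_or_ne (τ x) x with hfix | hmove
    · exact Or.inr ⟨x, (mem_filter_univ x).2 hfix, (setOf_sameCycle_eq_singleton hfix).symm⟩
    · have hmem : τ.cycleOf x ∈ τ.cycleFactorsFinset :=
        cycleOf_mem_cycleFactorsFinset_iff.2 (mem_support.2 hmove)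
      exact Or.inl ⟨τ.cycleOf x, hmem, coe_support_eq_setOf_sameCycle hmem
        ((mem_support_cycleOf_iff' hmove).2 (SameCycle.refl τ x))⟩
  · rintro (⟨c, hc, rfl⟩ | ⟨x, hx, rfl⟩)
    · obtain ⟨x, hx⟩ := (mem_cycleFactorsFinset_iff.1 hc).1.nonempty_support
      exact ⟨x, coe_support_eq_setOf_sameCycle hc hx⟩
    · have hfix : τ x = x := by simpa using hx
      exact ⟨x, (setOf_sameCycle_eq_singleton hfix).symm⟩

theorem injOn_support_cycleFactorsFinset (τ : Perm α) :
    Set.InjOn (fun c : Perm α => (c.support : Set α)) τ.cycleFactorsFinset := by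
  intro c hc d hd h
  obtain ⟨x, hx⟩ := (mem_cycleFactorsFinset_iff.1 hc).1.nonempty_support
  have hxd : x ∈ d.support := coe_injective h ▸ hx
  rw [cycle_is_cycleOf hx hc, cycle_is_cycleOf hxd hd]

theorem ncard_classes_sameCycle (τ : Perm α) :
    (SameCycle.setoid τ).classes.ncard = τ.cycleType.card + #{x | τ x = x} := by
  have hdisj : _root_.Disjoint ((fun c : Perm α => (c.support : Set α)) '' τ.cycleFactorsFinset)
      (singleton '' (({x | τ x = x} : Finset α) : Set α)) := by
    rw [Set.disjoint_left]
    rintro _ ⟨c, hc, rfl⟩ ⟨x, hx, hxc⟩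
    have hfix : τ x = x := by simpa using hx
    have hxc : x ∈ c.support := mem_coe.1 (hxc.subset (Set.mem_singleton x))
    exact mem_support.1 (mem_cycleFactorsFinset_support_le hc hxc) hfix
  rw [classes_sameCycle_eq_union, Set.ncard_union_eq hdisj,
    (injOn_support_cycleFactorsFinset τ).ncard_image, Set.ncard_coe_finset,
    Set.ncard_image_of_injective _ Set.singleton_injective, Set.ncard_coe_finset, cycleType_def,
    Multiset.card_map, card_def]

end Orbits

section StarPerm

open Equiv Equiv.Perm Finset

variable {n : ℕ}

/-- The bijection `σ*`, extended to `{0, …, n}` by `0 ↦ n`, which closes the path from `n` to `0`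
to a cycle. -/
def starPerm (σ : Perm (Fin n)) : Perm (Fin (n + 1)) :=
  (finRotate (n + 1))⁻¹ * decomposeFin.symm (0, σ)

theorem starPerm_succ (σ : Perm (Fin n)) (i : Fin n) : starPerm σ i.succ = starFun σ i := by
  rw [starPerm, mul_apply, Perm.inv_def, symm_apply_eq, starFun]
  simp [decomposeFin_symm_apply_succ]

theorem starPerm_bot (σ : Perm (Fin n)) : starPerm σ ⊥ = ⊤ := by
  rw [starPerm, mul_apply, Perm.inv_def, symm_apply_eq]
  exact (decomposeFin_symm_apply_zero 0 σ).trans finRotate_last.symm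

theorem starPerm_injective : Function.Injective (starPerm (n := n)) := fun _ _ h =>
  (Prod.mk.inj (decomposeFin.symm.injective (mul_left_cancel h))).2

theorem exists_starPerm_eq {τ : Perm (Fin (n + 1))} (hτ : τ ⊥ = ⊤) :
    ∃ σ : Perm (Fin n), starPerm σ = τ := by
  obtain ⟨⟨i, σ⟩, hiσ⟩ := decomposeFin.symm.surjective (finRotate (n + 1) * τ)
  have hi : i = 0 := by
    rw [← decomposeFin_symm_apply_zero i σ, hiσ, mul_apply]
    exact (congrArg _ hτ).trans finRotate_last
  exact ⟨σ, by rw [starPerm, ← hi, hiσ, inv_mul_cancel_left]⟩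

theorem sum_starPerm {M : Type*} [AddCommMonoid M] (p : Perm (Fin (n + 1)) → Prop)
    [DecidablePred p] (f : Perm (Fin (n + 1)) → M) :
    ∑ σ with p (starPerm σ), f (starPerm σ) = ∑ τ with τ ⊥ = ⊤ ∧ p τ, f τ := by
  refine sum_bij (fun σ _ => starPerm σ) (fun σ hσ => ?_) (fun _ _ _ _ h => starPerm_injective h)
    (fun τ hτ => ?_) fun _ _ => rfl
  · exact (mem_filter_univ _).2 ⟨starPerm_bot σ, (mem_filter_univ σ).1 hσ⟩
  · obtain ⟨hτ_bot, hp⟩ := (mem_filter_univ τ).1 hτ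
    obtain ⟨σ, rfl⟩ := exists_starPerm_eq hτ_bot
    exact ⟨σ, (mem_filter_univ σ).2 hp, rfl⟩

theorem excNum_add_one (σ : Perm (Fin n)) :
    excNum σ + 1 = #(cycAscents (starPerm σ)) + #(cycValleys (starPerm σ)) := by
  rw [card_cycAscents_add_card_cycValleys, Fin.card_filter_univ_succ, if_pos (Fin.zero_le _)]
  simp only [starPerm_succ, starFun, Fin.succ_le_castSucc_iff, excNum]

theorem fixStar_eq_card_fixed (hn : n ≠ 0) (σ : Perm (Fin n)) :
    fixStar σ = #{x | starPerm σ x = x} := by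
  have hbot : starPerm σ 0 ≠ 0 := fun h => hn (congrArg Fin.val ((starPerm_bot σ).symm.trans h))
  rw [Fin.card_filter_univ_succ, if_neg hbot]
  simp only [starPerm_succ, fixStar]

theorem exists_starFun_iff (σ : Perm (Fin n)) {r : Fin (n + 1) → Fin (n + 1) → Prop}
    {x : Fin (n + 1)} :
    (∃ i j : Fin n, starFun σ i = x ∧ j.succ = x ∧ x < i.succ ∧ r x (starFun σ j)) ↔
      x ≠ ⊥ ∧ x < (starPerm σ).symm x ∧ r x (starPerm σ x) := by
  constructor
  · rintro ⟨i, j, hi, rfl, hlt, hr⟩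
    rw [← starPerm_succ, ← eq_symm_apply] at hi
    rw [← hi, starPerm_succ]
    exact ⟨Fin.succ_ne_zero j, hlt, hr⟩
  · rintro ⟨hx, hlt, hr⟩
    obtain ⟨j, rfl⟩ := Fin.exists_succ_eq.2 hx
    obtain ⟨i, hi⟩ := Fin.exists_succ_eq.2 (Fin.ne_zero_of_lt hlt)
    rw [starPerm_succ] at hr
    refine ⟨i, j, ?_, rfl, hi ▸ hlt, hr⟩
    rw [← starPerm_succ, hi, apply_symm_apply]

theorem cvalleyStar_add_one (hn : n ≠ 0) (σ : Perm (Fin n)) :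
    cvalleyStar σ + 1 = #(cycValleys (starPerm σ)) := by
  have : Nontrivial (Fin (n + 1)) := Fin.nontrivial_iff_two_le.2 (by omega)
  rw [← card_erase_add_one (bot_mem_cycValleys (starPerm_bot σ)), cvalleyStar]
  congr 2
  ext x
  rw [mem_filter_univ, exists_starFun_iff σ (r := fun a b => a < b), mem_erase,
    mem_cycValleys_iff_lt, and_comm (a := x < _)]

theorem cddStar_eq_card_cycDescents (σ : Perm (Fin n)) :
    cddStar σ = #(cycDescents (starPerm σ)) := by
  rw [cddStar]
  congr 1
  ext x
  rw [mem_filter_univ, exists_starFun_iff σ (r := fun a b => b < a), mem_cycDescents,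
    and_comm (a := x < _)]
  exact and_iff_right_of_imp fun h => Fin.ne_zero_of_lt h.1

end StarPerm

section StarCycles

open Equiv Equiv.Perm Finset

variable {n : ℕ} {σ : Perm (Fin n)} {x y : Fin (n + 1)}

theorem starEdge_iff : StarEdge σ x y ↔ x ≠ ⊥ ∧ starPerm σ x = y := by
  constructor
  · rintro ⟨i, rfl, h⟩
    exact ⟨Fin.succ_ne_zero i, (starPerm_succ σ i).trans h⟩
  · rintro ⟨hx, h⟩
    obtain ⟨i, rfl⟩ := Fin.exists_succ_eq.2 hx
    exact ⟨i, rfl, (starPerm_succ σ i).symm.trans h⟩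

theorem sameCycle_of_transGen (h : Relation.TransGen (StarEdge σ) x y) :
    (starPerm σ).SameCycle x y := by
  induction h with
  | single h =>
    obtain ⟨-, rfl⟩ := starEdge_iff.1 h
    exact (SameCycle.refl _ _).apply_right
  | tail _ h ih =>
    obtain ⟨-, rfl⟩ := starEdge_iff.1 h
    exact ih.apply_right

theorem transGen_of_sameCycle (hx : ¬ (starPerm σ).SameCycle x ⊥)
    (h : (starPerm σ).SameCycle x y) : Relation.TransGen (StarEdge σ) x y := by
  have hedge (k : ℕ) : StarEdge σ ((starPerm σ ^ k) x) ((starPerm σ ^ (k + 1)) x) :=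
    starEdge_iff.2 ⟨fun h => hx ⟨k, by simpa using h⟩, by rw [pow_succ', mul_apply]⟩
  obtain ⟨k, hk, -, rfl⟩ := h.exists_pow_eq''
  induction k, hk using Nat.le_induction with
  | base => exact .single (hedge 0)
  | succ k _ ih => exact (ih (SameCycle.refl _ _).pow_right).tail (hedge k)

theorem not_sameCycle_bot_of_transGen (h : Relation.TransGen (StarEdge σ) x x) :
    ¬ (starPerm σ).SameCycle x ⊥ := by
  have hstep : ∀ y, Relation.TransGen (StarEdge σ) y x →
      y ≠ ⊥ ∧ Relation.TransGen (StarEdge σ) (starPerm σ y) x := by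
    intro y hy
    obtain ⟨z, hyz, hzx⟩ := Relation.TransGen.head'_iff.1 hy
    obtain ⟨hy_bot, rfl⟩ := starEdge_iff.1 hyz
    rcases Relation.reflTransGen_iff_eq_or_transGen.1 hzx with heq | hzx
    · exact ⟨hy_bot, heq ▸ h⟩
    · exact ⟨hy_bot, hzx⟩
  have hpow (k : ℕ) : Relation.TransGen (StarEdge σ) ((starPerm σ ^ k) x) x := by
    induction k with
    | zero => exact h
    | succ k ih =>
      rw [pow_succ', mul_apply]
      exact (hstep _ ih).2
  intro hbot
  obtain ⟨k, -, hk⟩ := hbot.exists_pow_eq'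
  exact (hstep _ (hpow k)).1 hk

theorem starCycles_eq (σ : Perm (Fin n)) :
    starCycles σ =
      (SameCycle.setoid (starPerm σ)).classes \ {{y | (starPerm σ).SameCycle y ⊥}} := by
  ext C
  constructor
  · rintro ⟨x, hx, rfl⟩
    have hbot := not_sameCycle_bot_of_transGen hx
    have hC : {y | Relation.TransGen (StarEdge σ) x y} = {y | (starPerm σ).SameCycle y x} := by
      ext y
      exact ⟨fun h => (sameCycle_of_transGen h).symm, fun h => transGen_of_sameCycle hbot h.symm⟩
    rw [hC]
    refine ⟨⟨x, rfl⟩, fun h => hbot ?_⟩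
    exact h.subset (SameCycle.refl (starPerm σ) x)
  · rintro ⟨⟨x, rfl⟩, hne⟩
    have hbot : ¬ (starPerm σ).SameCycle x ⊥ := by
      intro h
      refine hne (Set.ext fun y => ?_)
      exact ⟨fun hy => SameCycle.trans hy h, fun hy => SameCycle.trans hy h.symm⟩
    refine ⟨x, transGen_of_sameCycle hbot (SameCycle.refl _ _), Set.ext fun y => ?_⟩
    exact ⟨fun h => transGen_of_sameCycle hbot (SameCycle.symm h),
      fun h => (sameCycle_of_transGen h).symm⟩

theorem cycStar_sub_fixStar_add_one (hn : n ≠ 0) (σ : Perm (Fin n)) :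
    cycStar σ - fixStar σ + 1 = (starPerm σ).cycleType.card := by
  have hclasses : cycStar σ + 1 = (SameCycle.setoid (starPerm σ)).classes.ncard := by
    rw [cycStar, starCycles_eq]
    exact Set.ncard_sdiff_singleton_add_one ⟨⊥, rfl⟩
  rw [ncard_classes_sameCycle, ← fixStar_eq_card_fixed hn] at hclasses
  have hle := fixStar_le_cycStar σ
  omega

end StarCycles

section Expansion

open Equiv Finset

variable {n : ℕ}

theorem excNum_eq_cvalleyStar_add (hn : n ≠ 0) (σ : Perm (Fin n)) :
    excNum σ = cvalleyStar σ + #(cycAscents (starPerm σ)) := by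
  have hexc := excNum_add_one σ
  have hvalley := cvalleyStar_add_one hn σ
  omega

theorem card_cycAscents_add_cddStar_add (hn : n ≠ 0) (σ : Perm (Fin n)) :
    #(cycAscents (starPerm σ)) + cddStar σ + 2 * cvalleyStar σ = n - 1 := by
  have hcard := card_cycAscents_add_card_cycDescents_add (starPerm σ)
  rw [← cddStar_eq_card_cycDescents, ← cvalleyStar_add_one hn, Fintype.card_fin] at hcard
  omega

theorem sum_pow_mul_pow_excNum {R : Type*} [CommSemiring R] (hn : n ≠ 0) (β t : R) :
    ∑ σ : Perm (Fin n), β ^ (cycStar σ - fixStar σ) * t ^ excNum σ =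
      ∑ σ : Perm (Fin n) with cddStar σ = 0,
        β ^ (cycStar σ - fixStar σ) * t ^ cvalleyStar σ *
          (1 + t) ^ (n - 1 - 2 * cvalleyStar σ) := by
  have : Nontrivial (Fin (n + 1)) := Fin.nontrivial_iff_two_le.2 (by omega)
  let Φ (τ : Perm (Fin (n + 1))) : R := β ^ (τ.cycleType.card - 1) * t ^ (#(cycValleys τ) - 1)
  have hΦ_isolate (τ : Perm (Fin (n + 1))) (x) (hx : x ∈ Set.uIcc (τ.symm x) (τ x)) :
      Φ (isolate τ x) = Φ τ := by
    simp only [Φ, card_cycleType_isolate hx, cycValleys_isolate hx]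
  have hΦ_starPerm (σ : Perm (Fin n)) :
      Φ (starPerm σ) = β ^ (cycStar σ - fixStar σ) * t ^ cvalleyStar σ := by
    simp only [Φ, ← cycStar_sub_fixStar_add_one hn, ← cvalleyStar_add_one hn, Nat.add_sub_cancel]
  calc ∑ σ : Perm (Fin n), β ^ (cycStar σ - fixStar σ) * t ^ excNum σ
    _ = ∑ σ with True, Φ (starPerm σ) *
          (t ^ #(cycAscents (starPerm σ)) * 1 ^ #(cycDescents (starPerm σ))) := by
      simp only [hΦ_starPerm, excNum_eq_cvalleyStar_add hn, pow_add, one_pow, mul_one, mul_assoc,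
        filter_true]
    _ = ∑ τ with τ ⊥ = ⊤, Φ τ * (t ^ #(cycAscents τ) * 1 ^ #(cycDescents τ)) := by
      rw [sum_starPerm (fun _ => True)
        (fun τ => Φ τ * (t ^ #(cycAscents τ) * 1 ^ #(cycDescents τ)))]
      simp only [and_true]
    _ = ∑ τ with τ ⊥ = ⊤ ∧ cycDescents τ = ∅, Φ τ * (t + 1) ^ #(cycAscents τ) :=
      sum_mul_pow_card_cycAscents_mul_pow_card_cycDescents hΦ_isolate t 1
    _ = ∑ σ with cycDescents (starPerm σ) = ∅,
          Φ (starPerm σ) * (t + 1) ^ #(cycAscents (starPerm σ)) :=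
      (sum_starPerm (fun τ => cycDescents τ = ∅) _).symm
    _ = _ := by
      simp only [← card_eq_zero (s := cycDescents _), ← cddStar_eq_card_cycDescents]
      refine sum_congr rfl fun σ hσ => ?_
      have hcdd : cddStar σ = 0 := (mem_filter_univ σ).1 hσ
      have hasc : #(cycAscents (starPerm σ)) = n - 1 - 2 * cvalleyStar σ := by
        have hcard := card_cycAscents_add_cddStar_add hn σ
        omega
      rw [hΦ_starPerm, add_comm t, hasc]

theorem sum_C_dPoly_mul (hn : n ≠ 0) (f : ℕ → ℤ[X][X]) :
    ∑ k ∈ range ((n - 1) / 2 + 1), C (dPoly n k) * f k =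
      ∑ σ : Perm (Fin n) with cddStar σ = 0,
        C (X ^ (cycStar σ - fixStar σ)) * f (cvalleyStar σ) := by
  have hmaps : ∀ σ ∈ ({σ | cddStar σ = 0} : Finset (Perm (Fin n))),
      cvalleyStar σ ∈ range ((n - 1) / 2 + 1) := by
    intro σ _
    have hcard := card_cycAscents_add_cddStar_add hn σ
    rw [mem_range]
    omega
  rw [← sum_fiberwise_of_maps_to hmaps]
  refine sum_congr rfl fun k _ => ?_
  rw [dPoly, map_sum, sum_mul, filter_filter]
  simp only [and_comm (a := cddStar _ = 0)]
  refine sum_congr rfl fun σ hσ => ?_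
  rw [((mem_filter_univ σ).1 hσ).1]

theorem isRoot_dPoly (hn : n ≠ 0) {k : ℕ} (hk : 1 ≤ k) : (dPoly n k).IsRoot (-1) := by
  have hsum : ∑ σ : Perm (Fin n) with cvalleyStar σ = k ∧ cddStar σ = 0,
      (-1 : ℤ) ^ (cycStar σ - fixStar σ + 1) = 0 := by
    rw [← sum_neg_one_pow_card_cycleType_eq_zero (α := Fin (n + 1)) (Nat.lt_add_one_iff.2 hk),
      ← sum_starPerm (fun τ => #(cycValleys τ) = k + 1 ∧ cycDescents τ = ∅)]
    simp only [← cvalleyStar_add_one hn, ← card_eq_zero (s := cycDescents _),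
      ← cddStar_eq_card_cycDescents, ← cycStar_sub_fixStar_add_one hn, Nat.add_right_cancel_iff]
  simp only [pow_succ, ← sum_mul] at hsum
  rw [IsRoot.def, dPoly, eval_finsetSum]
  simpa using hsum

end Expansion

/-- The expansion is an identity in `ℤ[β][t]`: the inner variable is `β` (as a coefficient, `C X`),
the outer variable is `t`. -/
theorem mainTheorem7 (n : ℕ) (hn : 1 ≤ n) :
    (∑ σ : Equiv.Perm (Fin n),
        C ((X : ℤ[X]) ^ (cycStar σ - fixStar σ)) * (X : ℤ[X][X]) ^ excNum σ =
      ∑ k ∈ Finset.range ((n - 1) / 2 + 1),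
        C (dPoly n k) * (X : ℤ[X][X]) ^ k * (1 + X) ^ (n - 1 - 2 * k)) ∧
    ∀ k : ℕ, 1 ≤ k → (X + 1 : ℤ[X]) ∣ dPoly n k := by
  have hn' : n ≠ 0 := Nat.one_le_iff_ne_zero.1 hn
  constructor
  · simp only [mul_assoc, sum_C_dPoly_mul hn' fun k => X ^ k * (1 + X) ^ (n - 1 - 2 * k), C_pow]
    simpa only [mul_assoc] using sum_pow_mul_pow_excNum hn' (C X) (X : ℤ[X][X])
  · intro k hk
    simpa using dvd_iff_isRoot.2 (isRoot_dPoly hn' hk)
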